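/- **Theorem.** Let $k$ be a field of characteristic zero and let $M,N\ge 2$ be integers such that either $M=2$ and $N$ is prime, or $M$ is prime and $N=2$. Let $$\Gamma_{M,N}=\langle g_0,\dots,g_{M-1}\mid g_0^N=\dots=g_{M-1}^N=1,\ [g_{i_1}\cdots g_{i_N},\,g_{j_1}\cdots g_{j_N}]=1 \rangle,$$ where the commutator relations range over all $i_1,\dots,i_N,j_1,\dots,j_N\in\{0,\dots,M-1\}$, and let the cyclic group $\mathbb Z_M=\langle h\rangle$ act on $\Gamma_{M,N}$ by $h\cdot g_i=g_{i+1}$ (indices modulo $M$). Let $k[\Gamma_{M,N}]\rtimes k^{\mathbb Z_M}$ be the smash coproduct Hopf algebra: as an algebra it is $k[\Gamma_{M,N}]\otimes k^{\mathbb Z_M}$ (with $r\#f$ standing for $r\otimes f$ and $\delta_x$ for the indicator function of $x$), and its comultiplication, counit and antipode are $$\Delta(r\#\delta_x)=\sum_{l\in\mathbb Z_M} (r\#\delta_l)\otimes (l^{-1}\cdot r\,\#\,\delta_{l^{-1}x}),\qquad \varepsilon(r\#\delta_x)=\delta_{x,1},\qquad S(r\#\delta_x)=x^{-1}\cdot r^{-1}\,\#\,\delta_{x^{-1}}.$$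 Let $Q=(Q_{ic})$, $0\le i\le M-1$, $0\le c\le N-1$, be a matrix with entries in $k^\times$ such that $Q_{0c}=1=Q_{i0}$ for all $i,c$ (indices modulo $M$ and $N$ respectively), and put $\theta_{ic}=\dfrac{Q_{i-1,c}\,Q_{i,c-1}}{Q_{ic}\,Q_{i-1,c-1}}$. With $\epsilon_0,\dots,\epsilon_{N-1}$ the canonical basis of $k^N$ (indices modulo $N$), let $\rho_Q:k[\Gamma_{M,N}]\rtimes k^{\mathbb Z_M}\to \mathrm{End}(k^N)$ be the algebra map determined by $$\rho_Q(g_i\#1)(\epsilon_c)=\theta_{ic}\,\epsilon_{c-1},\qquad \rho_Q(1\#f)=f(h)\,\mathrm{id}.$$ If at least one of the elements $Q_{ic}$ is not a root of unity, then $\rho_Q$ is inner faithful. Here an algebra map $\rho:A\to R$ from a Hopf algebra $A$ to an algebra $R$ is called *inner faithful* if $(A,\mathrm{id}_A,\rho)$ is its Hopf image, that is, a final object among the triples $(L,q,\varphi)$ in which $L$ is a Hopf algebra, $q:A\to L$ is a surjective Hopf algebra map and $\varphi:L\to R$ is an algebra map with $\rho=\varphi q$: for every such triple there is a unique Hopf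 algebra map $f:L\to A$ with $fq=\mathrm{id}_A$ and $\rho f=\varphi$. -/

import Mathlib

set_option linter.unusedSectionVars false

open scoped TensorProduct

noncomputable section

/-! ### The smash coproduct Hopf algebra -/

/-- The underlying algebra of the smash coproduct `k[Γ] ⋊ k^H`: the tensor product algebra
`k[Γ] ⊗ k^H`, where `k^H` is the algebra of functions on `H`. It is a type synonym, since its
coalgebra structure is not the tensor product one. -/
def SmashCoproduct (k Γ H : Type*) [Field k] [Group Γ] [Group H] : Type _ :=
  MonoidAlgebra k Γ ⊗[k] (H → k)

namespace SmashCoproduct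

section Algebra

variable (k Γ H : Type*) [Field k] [Group Γ] [Group H]

instance : Ring (SmashCoproduct k Γ H) :=
  inferInstanceAs (Ring (MonoidAlgebra k Γ ⊗[k] (H → k)))

instance : Algebra k (SmashCoproduct k Γ H) :=
  inferInstanceAs (Algebra k (MonoidAlgebra k Γ ⊗[k] (H → k)))

variable {k Γ H}

/-- The element `r # f` of the smash coproduct, for `r ∈ Γ` and `f ∈ k^H`. -/
def elt (r : Γ) (f : H → k) : SmashCoproduct k Γ H :=
  (MonoidAlgebra.single r (1 : k) ⊗ₜ[k] f : MonoidAlgebra k Γ ⊗[k] (H → k))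

/-- `r # f` as a linear function of `f`. -/
def eltLin (r : Γ) : (H → k) →ₗ[k] SmashCoproduct k Γ H :=
  TensorProduct.mk k (MonoidAlgebra k Γ) (H → k) (MonoidAlgebra.single r (1 : k))

@[simp] lemma eltLin_apply (r : Γ) (f : H → k) : eltLin r f = elt r f := rfl

lemma elt_mul (r s : Γ) (f g : H → k) : elt r f * elt s g = elt (r * s) (f * g) := by
  refine (Algebra.TensorProduct.tmul_mul_tmul _ _ _ _).trans ?_
  simp [elt, MonoidAlgebra.single_mul_single]

lemma one_eq : (1 : SmashCoproduct k Γ H) = elt 1 1 := rfl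

lemma elt_add (r : Γ) (f g : H → k) : elt r (f + g) = elt r f + elt r g :=
  (eltLin r).map_add f g

lemma elt_smul (r : Γ) (a : k) (f : H → k) : elt r (a • f) = a • elt r f :=
  (eltLin r).map_smul a f

lemma elt_zero (r : Γ) : elt r (0 : H → k) = 0 := (eltLin r).map_zero

lemma elt_sum {ι : Type*} (s : Finset ι) (r : Γ) (f : ι → H → k) :
    elt r (∑ i ∈ s, f i) = ∑ i ∈ s, elt r (f i) := map_sum (eltLin r) f s

/-- The linear map out of the smash coproduct with prescribed values `F r f` on `r # f`. -/
def linLift {P : Type*} [AddCommGroup P] [Module k P] (F : Γ → (H → k) →ₗ[k] P) :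
    SmashCoproduct k Γ H →ₗ[k] P :=
  TensorProduct.lift
    ((Finsupp.lsum k fun r => (LinearMap.lsmul k ((H → k) →ₗ[k] P)).flip (F r)) ∘ₗ
      (MonoidAlgebra.coeffLinearEquiv k).toLinearMap)

lemma linLift_elt {P : Type*} [AddCommGroup P] [Module k P] (F : Γ → (H → k) →ₗ[k] P)
    (r : Γ) (f : H → k) : linLift F (elt r f) = F r f := by
  refine (TensorProduct.lift.tmul _ _).trans ?_
  simp

lemma linearMap_ext {P : Type*} [AddCommGroup P] [Module k P]
    {φ ψ : SmashCoproduct k Γ H →ₗ[k] P} (h : ∀ r f, φ (elt r f) = ψ (elt r f)) : φ = ψ := by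
  refine TensorProduct.ext (MonoidAlgebra.lhom_ext' fun r => LinearMap.ext fun a => ?_)
  refine LinearMap.ext fun f => ?_
  have e : (MonoidAlgebra.single r a ⊗ₜ[k] f : MonoidAlgebra k Γ ⊗[k] (H → k)) =
      a • (elt r f : SmashCoproduct k Γ H) := by
    refine Eq.trans ?_ (TensorProduct.smul_tmul' a (MonoidAlgebra.single r (1 : k)) f).symm
    simp
  change φ (MonoidAlgebra.single r a ⊗ₜ[k] f : MonoidAlgebra k Γ ⊗[k] (H → k)) =
    ψ (MonoidAlgebra.single r a ⊗ₜ[k] f : MonoidAlgebra k Γ ⊗[k] (H → k))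
  rw [e]
  exact (map_smul φ _ _).trans ((congrArg (a • ·) (h r f)).trans (map_smul ψ _ _).symm)

/-- The algebra map out of `k[Γ] ⊗ k^H` given by a multiplicative map on `Γ` and an algebra map on
`k^H` whose images commute. -/
def algLift {R : Type*} [Ring R] [Algebra k R] (F : Γ →* R) (φ : (H → k) →ₐ[k] R)
    (hc : ∀ r f, Commute (F r) (φ f)) : SmashCoproduct k Γ H →ₐ[k] R :=
  Algebra.TensorProduct.lift (MonoidAlgebra.lift k R Γ F) φ (fun x f => by
    induction x using MonoidAlgebra.induction_linear with
    | zero => simp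
    | add x y hx hy => rw [map_add]; exact hx.add_left hy
    | single r a => rw [MonoidAlgebra.lift_single]; exact (hc r f).smul_left a)

lemma algLift_elt {R : Type*} [Ring R] [Algebra k R] (F : Γ →* R) (φ : (H → k) →ₐ[k] R)
    (hc : ∀ r f, Commute (F r) (φ f)) (r : Γ) (f : H → k) :
    algLift F φ hc (elt r f) = F r * φ f := by
  refine (Algebra.TensorProduct.lift_tmul _ _ _ _ _).trans ?_
  simp

end Algebra

section Hopf

variable (k Γ H : Type*) [Field k] [Group Γ] [Group H] [Fintype H] [DecidableEq H]
  [MulDistribMulAction H Γ]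

/-- The linear map underlying the comultiplication:
`r # f ↦ ∑ l, (r # δ_l) ⊗ (l⁻¹ • r # f(l ·))`. -/
def comulLin : SmashCoproduct k Γ H →ₗ[k] SmashCoproduct k Γ H ⊗[k] SmashCoproduct k Γ H :=
  linLift fun r => ∑ l : H,
    (TensorProduct.mk k _ _ (elt r (Pi.single l (1 : k)))) ∘ₗ
      (eltLin (l⁻¹ • r)) ∘ₗ (LinearMap.funLeft k k (fun x : H => l * x))

/-- The linear map underlying the counit: `r # f ↦ f 1`. -/
def counitLin : SmashCoproduct k Γ H →ₗ[k] k := linLift fun _ => LinearMap.proj 1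

/-- The antipode: `r # f ↦ ∑ h, f h • (h⁻¹ • r⁻¹ # δ_{h⁻¹})`. -/
def antipodeLin : SmashCoproduct k Γ H →ₗ[k] SmashCoproduct k Γ H :=
  linLift fun r => ∑ h : H,
    (LinearMap.proj h : (H → k) →ₗ[k] k).smulRight (elt (h⁻¹ • r⁻¹) (Pi.single h⁻¹ (1 : k)))

variable {k Γ H}

lemma comulLin_elt (r : Γ) (f : H → k) :
    comulLin k Γ H (elt r f) = ∑ l : H,
      elt r (Pi.single l (1 : k)) ⊗ₜ[k] elt (l⁻¹ • r) (fun x => f (l * x)) := by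
  rw [comulLin, linLift_elt, LinearMap.sum_apply]
  rfl

lemma counitLin_elt (r : Γ) (f : H → k) : counitLin k Γ H (elt r f) = f 1 := by
  rw [counitLin, linLift_elt]; rfl

lemma antipodeLin_elt (r : Γ) (f : H → k) :
    antipodeLin k Γ H (elt r f) =
      ∑ h : H, f h • elt (h⁻¹ • r⁻¹) (Pi.single h⁻¹ (1 : k)) := by
  rw [antipodeLin, linLift_elt, LinearMap.sum_apply]
  rfl

lemma antipodeLin_elt_single (r : Γ) (h : H) :
    antipodeLin k Γ H (elt r (Pi.single h (1 : k))) = elt (h⁻¹ • r⁻¹) (Pi.single h⁻¹ (1 : k)) := by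
  rw [antipodeLin_elt, Finset.sum_eq_single h]
  · simp
  · intro b _ hb; simp [hb]
  · simp

lemma comp_mul_single (l m : H) :
    (fun x => (Pi.single m (1 : k) : H → k) (l * x)) = Pi.single (l⁻¹ * m) (1 : k) := by
  funext x
  simp only [Pi.single_apply, eq_inv_mul_iff_mul_eq]

lemma elt_eq_sum (r : Γ) (f : H → k) : elt r f = ∑ h : H, f h • elt r (Pi.single h (1 : k)) := by
  simp_rw [← elt_smul]
  rw [← elt_sum]
  congr 1
  funext x
  simp [Finset.sum_apply, Pi.single_apply]

lemma linearMap_ext_single {P : Type*} [AddCommGroup P] [Module k P]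
    {φ ψ : SmashCoproduct k Γ H →ₗ[k] P}
    (h : ∀ r x, φ (elt r (Pi.single x (1 : k))) = ψ (elt r (Pi.single x (1 : k)))) : φ = ψ :=
  linearMap_ext fun r f => by simp_rw [elt_eq_sum r f, map_sum, map_smul, h]

lemma comulLin_elt_single (r : Γ) (h : H) :
    comulLin k Γ H (elt r (Pi.single h (1 : k))) = ∑ l : H,
      elt r (Pi.single l (1 : k)) ⊗ₜ[k] elt (l⁻¹ • r) (Pi.single (l⁻¹ * h) (1 : k)) := by
  simp_rw [comulLin_elt, comp_mul_single]

instance : Coalgebra k (SmashCoproduct k Γ H) where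
  comul := comulLin k Γ H
  counit := counitLin k Γ H
  coassoc := by
    refine linearMap_ext_single fun r h => ?_
    simp only [LinearMap.comp_apply, comulLin_elt_single, map_sum, LinearMap.rTensor_tmul,
      LinearMap.lTensor_tmul, TensorProduct.sum_tmul, TensorProduct.tmul_sum,
      LinearEquiv.coe_coe, TensorProduct.assoc_tmul]
    rw [Finset.sum_comm]
    refine Finset.sum_congr rfl fun l _ => ?_
    refine Fintype.sum_equiv (Equiv.mulLeft l⁻¹) _ _ fun m => ?_
    simp [smul_smul, mul_assoc]
  rTensor_counit_comp_comul := by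
    refine linearMap_ext_single fun r h => ?_
    simp only [LinearMap.comp_apply, comulLin_elt_single, map_sum, LinearMap.rTensor_tmul,
      counitLin_elt, TensorProduct.mk_apply]
    rw [Finset.sum_eq_single 1]
    · simp
    · intro b _ hb; simp [hb.symm]
    · simp
  lTensor_counit_comp_comul := by
    refine linearMap_ext_single fun r h => ?_
    simp only [LinearMap.comp_apply, comulLin_elt_single, map_sum, LinearMap.lTensor_tmul,
      counitLin_elt, LinearMap.flip_apply, TensorProduct.mk_apply]
    rw [Finset.sum_eq_single h]
    · simp
    · intro b _ hb
      rw [Pi.single_apply, if_neg, TensorProduct.tmul_zero]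
      intro e; exact hb (inv_mul_eq_one.mp e.symm)
    · simp

lemma comul_eq : (Coalgebra.comul : SmashCoproduct k Γ H →ₗ[k] _) = comulLin k Γ H := rfl

lemma counit_eq : (Coalgebra.counit : SmashCoproduct k Γ H →ₗ[k] k) = counitLin k Γ H := rfl

lemma bilin_ext {P : Type*} [AddCommGroup P] [Module k P]
    {φ ψ : SmashCoproduct k Γ H →ₗ[k] SmashCoproduct k Γ H →ₗ[k] P}
    (h : ∀ r f s g, φ (elt r f) (elt s g) = ψ (elt r f) (elt s g)) : φ = ψ :=
  linearMap_ext fun r f => linearMap_ext fun s g => h r f s g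

instance : Bialgebra k (SmashCoproduct k Γ H) where
  counit_one := by rw [counit_eq, one_eq, counitLin_elt]; rfl
  mul_compr₂_counit := by
    refine bilin_ext fun r f s g => ?_
    simp [counit_eq, elt_mul, counitLin_elt]
  comul_one := by
    rw [comul_eq, one_eq, comulLin_elt]
    simp only [smul_one]
    have : (fun x : H => (1 : H → k) x) = 1 := rfl
    rw [Algebra.TensorProduct.one_def, one_eq, elt_eq_sum 1 (1 : H → k), TensorProduct.sum_tmul]
    refine Finset.sum_congr rfl fun l _ => ?_
    rw [← elt_eq_sum]
    simp
    rfl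
  mul_compr₂_comul := by
    refine bilin_ext fun r f s g => ?_
    simp only [LinearMap.compr₂_apply, LinearMap.mul_apply', LinearMap.compl₁₂_apply, comul_eq,
      elt_mul, comulLin_elt, Finset.sum_mul_sum, Algebra.TensorProduct.tmul_mul_tmul]
    refine Finset.sum_congr rfl fun l _ => ?_
    rw [Finset.sum_eq_single l]
    · rw [smul_mul']
      congr 2
      rw [← Pi.single_mul, one_mul]
    · intro m _ hm
      have : (Pi.single l 1 * Pi.single m 1 : H → k) = 0 := by
        funext x
        by_cases hx : x = l
        · subst hx; simp [hm.symm]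
        · simp [hx]
      rw [this, elt_zero, TensorProduct.zero_tmul]
    · simp

lemma single_mul_single_ne {l m : H} (hm : l ≠ m) :
    (Pi.single l 1 * Pi.single m 1 : H → k) = 0 := by
  funext x
  by_cases hx : x = l
  · subst hx; simp [hm]
  · simp [hx]

instance : HopfAlgebra k (SmashCoproduct k Γ H) where
  antipode := antipodeLin k Γ H
  mul_antipode_rTensor_comul := by
    refine linearMap_ext_single fun r h => ?_
    simp only [LinearMap.comp_apply, comul_eq, counit_eq, comulLin_elt_single, map_sum,
      LinearMap.rTensor_tmul, antipodeLin_elt_single, LinearMap.mul'_apply, elt_mul,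
      counitLin_elt, Algebra.linearMap_apply]
    by_cases hh : h = 1
    · subst hh
      simp only [mul_one, ← Pi.single_mul, smul_inv', inv_mul_cancel, Pi.single_eq_same, map_one]
      rw [one_eq, elt_eq_sum 1 (1 : H → k)]
      refine Fintype.sum_equiv (Equiv.inv H) _ _ fun l => ?_
      simp
    · rw [Pi.single_apply, if_neg (Ne.symm hh), map_zero]
      refine Finset.sum_eq_zero fun l _ => ?_
      rw [single_mul_single_ne, elt_zero]
      simpa using hh
  mul_antipode_lTensor_comul := by
    refine linearMap_ext_single fun r h => ?_
    simp only [LinearMap.comp_apply, comul_eq, counit_eq, comulLin_elt_single, map_sum,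
      LinearMap.lTensor_tmul, antipodeLin_elt_single, LinearMap.mul'_apply, elt_mul,
      counitLin_elt, Algebra.linearMap_apply]
    by_cases hh : h = 1
    · subst hh
      simp only [mul_one, inv_inv, ← Pi.single_mul, smul_inv', smul_inv_smul, mul_inv_cancel,
        Pi.single_eq_same, map_one]
      rw [one_eq, elt_eq_sum 1 (1 : H → k)]
      simp
    · rw [Pi.single_apply, if_neg (Ne.symm hh), map_zero]
      refine Finset.sum_eq_zero fun l _ => ?_
      rw [single_mul_single_ne, elt_zero]
      intro e
      apply hh
      have : h⁻¹ * l = l := by simpa using e.symm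
      simpa using this

/-- The comultiplication `Δ(r # δ_h) = ∑ l, (r # δ_l) ⊗ (l⁻¹ • r # δ_{l⁻¹ h})`. -/
theorem comul_elt_single (r : Γ) (h : H) :
    Coalgebra.comul (R := k) (elt r (Pi.single h (1 : k)) : SmashCoproduct k Γ H) = ∑ l : H,
      elt r (Pi.single l (1 : k)) ⊗ₜ[k] elt (l⁻¹ • r) (Pi.single (l⁻¹ * h) (1 : k)) :=
  comulLin_elt_single r h

/-- The counit `ε(r # δ_h) = δ_{h,1}`. -/
theorem counit_elt_single (r : Γ) (h : H) :
    Coalgebra.counit (R := k) (elt r (Pi.single h (1 : k)) : SmashCoproduct k Γ H) =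
      if h = 1 then 1 else 0 := by
  rw [counit_eq, counitLin_elt, Pi.single_apply]
  simp only [eq_comm]

/-- The antipode `S(r # δ_h) = h⁻¹ • r⁻¹ # δ_{h⁻¹}`. -/
theorem antipode_elt_single (r : Γ) (h : H) :
    HopfAlgebra.antipode k (elt r (Pi.single h (1 : k)) : SmashCoproduct k Γ H) =
      elt (h⁻¹ • r⁻¹) (Pi.single h⁻¹ (1 : k)) :=
  antipodeLin_elt_single r h

end Hopf

end SmashCoproduct

/-! ### Hopf images and inner faithfulness -/

universe u v w

/-- A factorization `(L, q, φ)` of an algebra map `ρ : A → R` defined on a Hopf algebra `A`: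
`L` is a Hopf algebra, `q : A → L` is a surjective Hopf algebra map, `φ : L → R` is an algebra
map, and `ρ = φ ∘ q`. Since `q` is surjective, every such `L` has a copy in the universe of `A`. -/
structure HopfFactorization {k : Type u} {A : Type v} {R : Type w} [Field k] [Ring A]
    [HopfAlgebra k A] [Ring R] [Algebra k R] (ρ : A →ₐ[k] R) where
  /-- The Hopf algebra `L`. -/
  L : Type v
  /-- The ring structure of `L`. -/
  [ring : Ring L]
  /-- The Hopf algebra structure of `L`. -/
  [hopf : HopfAlgebra k L]
  /-- The surjective Hopf algebra map `q : A → L`. -/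
  q : A →ₐc[k] L
  surjective_q : Function.Surjective q
  /-- The algebra map `φ : L → R`. -/
  φ : L →ₐ[k] R
  fac : ∀ a, φ (q a) = ρ a

attribute [instance] HopfFactorization.ring HopfFactorization.hopf

namespace HopfFactorization

variable {k : Type u} {A : Type v} {R : Type w} [Field k] [Ring A] [HopfAlgebra k A] [Ring R]
  [Algebra k R]

/-- The factorization `(A, id, ρ)` of `ρ`. -/
def self (ρ : A →ₐ[k] R) : HopfFactorization ρ where
  L := A
  q := BialgHom.id k A
  surjective_q := Function.surjective_id
  φ := ρ
  fac _ := rfl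

/-- A factorization `F = (A_ρ, p, ρ')` is the Hopf image of `ρ` if it is a final object among the
factorizations: for every factorization `(L, q, φ)` there is a unique Hopf algebra map
`f : L → A_ρ` with `f ∘ q = p` and `ρ' ∘ f = φ`. -/
def IsHopfImage {ρ : A →ₐ[k] R} (F : HopfFactorization ρ) : Prop :=
  ∀ G : HopfFactorization ρ, ∃! f : G.L →ₐc[k] F.L,
    (∀ a, f (G.q a) = F.q a) ∧ ∀ x, F.φ (f x) = G.φ x

end HopfFactorization

/-- An algebra map `ρ : A → R` on a Hopf algebra `A` is inner faithful if `(A, id, ρ)` is the Hopf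
image of `ρ`. -/
def InnerFaithful {k : Type u} {A : Type v} {R : Type w} [Field k] [Ring A] [HopfAlgebra k A]
    [Ring R] [Algebra k R] (ρ : A →ₐ[k] R) : Prop :=
  (HopfFactorization.self ρ).IsHopfImage

/-! ### The groups `Γ_{M,N}` with their cyclic actions -/

section Groups

open scoped commutatorElement

/-- The relators of `Γ_{M,N}`: the powers `g_i ^ N` and the commutators
`[g_{i_1} ⋯ g_{i_N}, g_{j_1} ⋯ g_{j_N}]`. The generators are indexed by `ℤ/M`. -/
def GammaRels (M N : ℕ) : Set (FreeGroup (ZMod M)) :=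
  {x | ∃ i, x = FreeGroup.of i ^ N} ∪
  {x | ∃ i j : Fin N → ZMod M,
    x = ⁅(List.ofFn fun a => FreeGroup.of (i a)).prod, (List.ofFn fun a => FreeGroup.of (j a)).prod⁆}

/-- The group `Γ_{M,N}`. -/
abbrev Gamma (M N : ℕ) : Type := PresentedGroup (GammaRels M N)

namespace Gamma

/-- The generator `g_i` of `Γ_{M,N}`. -/
def g {M N : ℕ} (i : ZMod M) : Gamma M N := PresentedGroup.of i

variable {M N : ℕ}

/-- The group morphism out of `Γ_{M,N}` with prescribed values on the generators. -/
def lift {G : Type*} [Group G] (x : ZMod M → G) (hpow : ∀ i, x i ^ N = 1)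
    (hcomm : ∀ i j : Fin N → ZMod M,
      Commute (List.ofFn fun a => x (i a)).prod (List.ofFn fun a => x (j a)).prod) :
    Gamma M N →* G :=
  PresentedGroup.toGroup (f := x) (by
    rintro r (⟨i, rfl⟩ | ⟨i, j, rfl⟩)
    · simpa using hpow i
    · rw [map_commutatorElement, commutatorElement_eq_one_iff_commute]
      simpa [map_list_prod, List.map_ofFn, Function.comp_def] using hcomm i j)

@[simp] lemma lift_g {G : Type*} [Group G] (x : ZMod M → G) (hpow : ∀ i, x i ^ N = 1)
    (hcomm : ∀ i j : Fin N → ZMod M,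
      Commute (List.ofFn fun a => x (i a)).prod (List.ofFn fun a => x (j a)).prod)
    (i : ZMod M) : lift x hpow hcomm (g i) = x i :=
  PresentedGroup.toGroup.of _

lemma g_pow (i : ZMod M) : (g i : Gamma M N) ^ N = 1 := by
  have h : PresentedGroup.mk (GammaRels M N) (FreeGroup.of i ^ N) = 1 :=
    PresentedGroup.one_of_mem (Or.inl ⟨i, rfl⟩)
  rwa [map_pow] at h

lemma g_commute (i j : Fin N → ZMod M) :
    Commute (List.ofFn fun a => (g (i a) : Gamma M N)).prod
      (List.ofFn fun a => (g (j a) : Gamma M N)).prod := by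
  have h := PresentedGroup.one_of_mem (rels := GammaRels M N) (Or.inr ⟨i, j, rfl⟩)
  rw [map_commutatorElement, commutatorElement_eq_one_iff_commute] at h
  simp only [map_list_prod, List.map_ofFn, Function.comp_def] at h
  exact h

/-- The endomorphism `g_i ↦ g_{i+a}` of `Γ_{M,N}`. -/
def shift (a : ZMod M) : Gamma M N →* Gamma M N :=
  lift (fun i => g (i + a)) (fun _ => g_pow _) (fun _ _ => g_commute _ _)

/-- The action of the cyclic group `ℤ/M = ⟨h⟩` (written multiplicatively) on `Γ_{M,N}` by cyclic
permutation of the generators: `h ^ a` maps `g_i` to `g_{i+a}`. -/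
instance : MulDistribMulAction (Multiplicative (ZMod M)) (Gamma M N) where
  smul a := shift a.toAdd
  one_smul r := by
    change shift 0 r = MonoidHom.id _ r
    congr 1
    exact PresentedGroup.ext fun i => (lift_g ..).trans (by simp [g])
  mul_smul a b r := by
    change shift (a.toAdd + b.toAdd) r = (shift a.toAdd).comp (shift b.toAdd) r
    congr 1
    refine PresentedGroup.ext fun i => (lift_g ..).trans ?_
    change _ = shift _ (shift _ (g i))
    rw [shift, shift, lift_g, lift_g, add_comm a.toAdd, add_assoc]
  smul_mul a r s := map_mul (shift a.toAdd) r s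
  smul_one a := map_one (shift a.toAdd)

lemma smul_g (a : Multiplicative (ZMod M)) (i : ZMod M) :
    a • (g i : Gamma M N) = g (i + a.toAdd) := lift_g ..

end Gamma

end Groups

/-! ### The representations `ρ_Q` -/

section Representation

variable {k : Type*} [Field k] {M N : ℕ}

/-- The automorphism of `k^N` mapping the basis vector `ε_c` to `w_c ε_{c-1}`
(indices modulo `N`). -/
def weightedShift (w : ZMod N → kˣ) : (ZMod N → k) ≃ₗ[k] (ZMod N → k) where
  toFun v d := w (d + 1) * v (d + 1)
  map_add' v v' := by funext d; simp [mul_add]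
  map_smul' a v := by funext d; simp [mul_left_comm]
  invFun v d := ((w d)⁻¹ : kˣ) * v (d - 1)
  left_inv v := by funext d; simp
  right_inv v := by funext d; simp

lemma weightedShift_single (w : ZMod N → kˣ) (c : ZMod N) :
    weightedShift w (Pi.single c (1 : k)) = (w c : k) • Pi.single (c - 1) (1 : k) := by
  funext d
  by_cases h : d + 1 = c
  · subst h; simp [weightedShift]
  · have h' : d ≠ c - 1 := fun e => h (by simp [e])
    simp [weightedShift, h, h']

/-- The matrix `θ_{ic} = Q_{i-1,c} Q_{i,c-1} / (Q_{ic} Q_{i-1,c-1})`. -/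
def theta (Q : ZMod M → ZMod N → kˣ) (i : ZMod M) (c : ZMod N) : kˣ :=
  (Q (i - 1) c * Q i (c - 1)) / (Q i c * Q (i - 1) (c - 1))

lemma theta_eq (Q : ZMod M → ZMod N → kˣ) (i : ZMod M) (c : ZMod N) :
    theta Q i c = (Q (i - 1) c / Q i c) / (Q (i - 1) (c - 1) / Q i (c - 1)) := by
  rw [theta, div_div_div_eq]

lemma weightedShift_theta_pow (Q : ZMod M → ZMod N → kˣ) (i : ZMod M) (n : ℕ)
    (v : ZMod N → k) (d : ZMod N) :
    (weightedShift (theta Q i) ^ n) v d =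
      (((Q (i - 1) (d + n) / Q i (d + n)) / (Q (i - 1) d / Q i d) : kˣ) : k) * v (d + n) := by
  induction n generalizing d with
  | zero => simp
  | succ n ih =>
    rw [pow_succ', LinearEquiv.mul_apply]
    change (theta Q i (d + 1) : k) * _ = _
    rw [ih, ← mul_assoc, ← Units.val_mul, theta_eq]
    have e : d + 1 + (n : ZMod N) = d + ((n + 1 : ℕ) : ZMod N) := by push_cast; ring
    rw [e, add_sub_cancel_right, mul_comm (_ / _ : kˣ),
      div_mul_div_cancel]

lemma weightedShift_list (W : List (ZMod N → kˣ)) :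
    ∃ u : ZMod N → k, ∀ (v : ZMod N → k) (d : ZMod N),
      (W.map weightedShift).prod v d = u d * v (d + W.length) := by
  induction W with
  | nil => exact ⟨1, fun v d => by simp⟩
  | cons w W ih =>
    obtain ⟨u, hu⟩ := ih
    refine ⟨fun d => w (d + 1) * u (d + 1), fun v d => ?_⟩
    rw [List.map_cons, List.prod_cons, LinearEquiv.mul_apply]
    change (w (d + 1) : k) * _ = _
    rw [hu, ← mul_assoc]
    congr 2
    simp only [List.length_cons]
    push_cast
    ring

lemma weightedShift_commute (w w' : Fin N → ZMod N → kˣ) :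
    Commute (List.ofFn fun a => weightedShift (w a)).prod
      (List.ofFn fun a => weightedShift (w' a)).prod := by
  have key : ∀ w : Fin N → ZMod N → kˣ, ∃ u : ZMod N → k, ∀ (v : ZMod N → k) (d : ZMod N),
      (List.ofFn fun a => weightedShift (w a)).prod v d = u d * v d := by
    intro w
    obtain ⟨u, hu⟩ := weightedShift_list (List.ofFn w)
    refine ⟨u, fun v d => ?_⟩
    have := hu v d
    simpa [List.map_ofFn, Function.comp_def] using this
  obtain ⟨u, hu⟩ := key w
  obtain ⟨u', hu'⟩ := key w'
  refine LinearEquiv.ext fun v => funext fun d => ?_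
  rw [LinearEquiv.mul_apply, LinearEquiv.mul_apply, hu, hu', hu', hu, mul_left_comm]

/-- The restriction of `ρ_Q` to `Γ_{M,N}`: the generator `g_i` maps `ε_c` to `θ_{ic} ε_{c-1}`. -/
def rhoGamma (Q : ZMod M → ZMod N → kˣ) : Gamma M N →* ((ZMod N → k) ≃ₗ[k] (ZMod N → k)) :=
  Gamma.lift (fun i => weightedShift (theta Q i))
    (fun i => LinearEquiv.ext fun v => funext fun d => by simp [weightedShift_theta_pow])
    (fun _ _ => weightedShift_commute _ _)

lemma rhoQ_commute (Q : ZMod M → ZMod N → kˣ) (r : Gamma M N) (f : Multiplicative (ZMod M) → k) :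
    Commute
      (((LinearEquiv.automorphismGroup.toLinearMapMonoidHom).comp (rhoGamma Q)) r)
      (((Algebra.ofId k (Module.End k (ZMod N → k))).comp
        (Pi.evalAlgHom k (fun _ : Multiplicative (ZMod M) => k) (Multiplicative.ofAdd 1))) f) :=
  Algebra.commute_algebraMap_right (A := Module.End k (ZMod N → k)) (f (Multiplicative.ofAdd 1)) _

/-- The representation `ρ_Q : k[Γ_{M,N}] ⋊ k^{ℤ/M} → End(k^N)` with
`ρ_Q(g_i # 1)(ε_c) = θ_{ic} ε_{c-1}` and `ρ_Q(1 # f) = f(h) id`, where `h` is the generator `1` of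
`ℤ/M`. -/
def rhoQ (Q : ZMod M → ZMod N → kˣ) :
    SmashCoproduct k (Gamma M N) (Multiplicative (ZMod M)) →ₐ[k] Module.End k (ZMod N → k) :=
  SmashCoproduct.algLift
    ((LinearEquiv.automorphismGroup.toLinearMapMonoidHom).comp (rhoGamma Q))
    ((Algebra.ofId k (Module.End k (ZMod N → k))).comp
      (Pi.evalAlgHom k (fun _ : Multiplicative (ZMod M) => k) (Multiplicative.ofAdd 1)))
    (rhoQ_commute Q)

/-- `ρ_Q(g_i # 1)(ε_c) = θ_{ic} ε_{c-1}`. -/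
theorem rhoQ_g (Q : ZMod M → ZMod N → kˣ) (i : ZMod M) (c : ZMod N) :
    rhoQ Q (SmashCoproduct.elt (Gamma.g i) 1) (Pi.single c (1 : k)) =
      (theta Q i c : k) • Pi.single (c - 1) (1 : k) := by
  rw [rhoQ, SmashCoproduct.algLift_elt, map_one, mul_one]
  change rhoGamma Q (Gamma.g i) _ = _
  rw [rhoGamma, Gamma.lift_g, weightedShift_single]

/-- `ρ_Q(1 # f) = f(h) id`. -/
theorem rhoQ_fun (Q : ZMod M → ZMod N → kˣ) (f : Multiplicative (ZMod M) → k) :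
    rhoQ Q (SmashCoproduct.elt 1 f) = f (Multiplicative.ofAdd 1) • LinearMap.id := by
  rw [rhoQ, SmashCoproduct.algLift_elt, map_one, one_mul]
  rfl

end Representation

end

/-! By `InnerFaithful.of_injective` it suffices that every Hopf quotient `q` through which `ρ_Q`
factors is injective. The functionals that factor through `q` are closed under convolution, and they
contain the matrix coefficients of `ρ_Q`, all supported at `h`. An `n`-fold convolution of these is
supported at `h ^ n`, and its value at `r` is a product of coefficients of translates of `r`. The
`M`-fold ones return to `1 : H`, where the functions factoring through `q` form an algebra. If this
algebra separates the points of `Γ_{M,N}`, then `q` is injective (`injective_of_factors`).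

Two points that are not separated differ by an element `t` of degree `0` all of whose translates act
by scalar `N`-th roots of unity. Hence it is enough that `t = 1` whenever `t` has degree `0` and all
its translates act with finite order (`innerFaithful_rhoQ`).

The commutator relations make the degree-zero part abelian. In both cases it is generated by `u =
g_1 g_0⁻¹` under one operator `τ`: conjugation by `g_0` if `M = 2`, the cyclic shift if `N = 2`.
Moreover `1 + τ + ⋯ + τ^(p-1)` kills `u`, for the prime `p = N` or `p = M`, so this part is a cyclic
`ℤ[ζ_p]`-module. The elements `t` above form a `τ`-stable subgroup. A nonzero element `f(τ) u` in it
would, by a Bézout relation between `f` and `Φ_p`, put a nonzero multiple of `u` in it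
(`aeval_apply_eq_zero`). But then every entry of `Q` is a root of unity
(`isOfFinOrder_of_rhoGamma`). -/

noncomputable section

/-! ### Injectivity of Hopf quotients of a smash coproduct -/

section HopfQuotient

/-- An algebra map is inner faithful as soon as each of its factorizations is injective. -/
theorem InnerFaithful.of_injective {k : Type u} {A : Type v} {R : Type w} [Field k] [Ring A]
    [HopfAlgebra k A] [Ring R] [Algebra k R] {ρ : A →ₐ[k] R}
    (h : ∀ G : HopfFactorization ρ, Function.Injective G.q) : InnerFaithful ρ := by
  intro G
  let e : A ≃ₐc[k] G.L := BialgEquiv.ofBijective G.q ⟨h G, G.surjective_q⟩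
  have he : ∀ a, e.symm (G.q a) = a := e.symm_apply_apply
  refine ⟨(e.symm : G.L →ₐc[k] A), ⟨he, fun x => ?_⟩, fun f hf => ?_⟩
  · obtain ⟨a, rfl⟩ := G.surjective_q x
    exact (congrArg ρ (he a)).trans (G.fac a).symm
  · refine BialgHom.ext fun x => ?_
    obtain ⟨a, rfl⟩ := G.surjective_q x
    exact (hf.1 a).trans (he a).symm

namespace SmashCoproduct

variable {k Γ H : Type*} [Field k] [Group Γ] [Group H]

/-- The linear functional `r # f ↦ F r * f y`. -/
def functional (y : H) (F : Γ → k) : SmashCoproduct k Γ H →ₗ[k] k :=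
  linLift fun r => F r • LinearMap.proj y

lemma functional_elt (y : H) (F : Γ → k) (r : Γ) (f : H → k) :
    functional y F (elt r f) = F r * f y := by
  rw [functional, linLift_elt]; rfl

lemma exists_eq_sum_elt (a : SmashCoproduct k Γ H) :
    ∃ f : Γ →₀ (H → k), a = ∑ r ∈ f.support, elt r (f r) := by
  let Ψ : (Γ →₀ (H → k)) →ₗ[k] SmashCoproduct k Γ H := Finsupp.lsum k fun r => eltLin r
  have h : (LinearMap.range Ψ).mkQ = 0 := by
    refine linearMap_ext fun r f => ?_
    rw [LinearMap.zero_apply, Submodule.mkQ_apply, Submodule.Quotient.mk_eq_zero]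
    exact ⟨Finsupp.single r f, Finsupp.sum_single_index (map_zero (eltLin r))⟩
  have ha : a ∈ LinearMap.range Ψ := by
    rw [← Submodule.Quotient.mk_eq_zero, ← Submodule.mkQ_apply, h, LinearMap.zero_apply]
  obtain ⟨f, rfl⟩ := ha
  exact ⟨f, rfl⟩

variable [Fintype H] [DecidableEq H] [MulDistribMulAction H Γ]

/-- The convolution product of two functionals. -/
lemma functional_convolution (y z : H) (F G : Γ → k) :
    LinearMap.mul' k k ∘ₗ TensorProduct.map (functional y F) (functional z G) ∘ₗ
      (Coalgebra.comul : SmashCoproduct k Γ H →ₗ[k] _) =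
    functional (y * z) (fun r => F r * G (y⁻¹ • r)) := by
  refine linearMap_ext_single fun r x => ?_
  simp only [LinearMap.comp_apply, comul_elt_single, map_sum, TensorProduct.map_tmul,
    LinearMap.mul'_apply, functional_elt]
  rw [Finset.sum_eq_single y]
  · simp [Pi.single_apply, eq_inv_mul_iff_mul_eq]
  · intro b _ hb
    simp [hb.symm]
  · simp

variable {L : Type*} [Ring L] [HopfAlgebra k L] (q : SmashCoproduct k Γ H →ₐc[k] L)

/-- The functions `F` on `Γ` for which the functional `r # f ↦ F r * f y` factors through `q`. -/
def Factors (y : H) (F : Γ → k) : Prop := ∃ μ : L →ₗ[k] k, ∀ a, μ (q a) = functional y F a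

variable {q}

/-- Since `q` respects comultiplication, the convolution of two functionals on `L` pulls back to the
convolution of their pullbacks. The twist by `y⁻¹` comes from the smash comultiplication. -/
lemma Factors.mul {y z : H} {F G : Γ → k} (hF : Factors q y F) (hG : Factors q z G) :
    Factors q (y * z) (fun r => F r * G (y⁻¹ • r)) := by
  obtain ⟨μ, hμ⟩ := hF
  obtain ⟨ν, hν⟩ := hG
  refine ⟨LinearMap.mul' k k ∘ₗ TensorProduct.map μ ν ∘ₗ Coalgebra.comul, fun a => ?_⟩
  have h1 : μ ∘ₗ (q : SmashCoproduct k Γ H →ₗ[k] L) = functional y F := LinearMap.ext hμ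
  have h2 : ν ∘ₗ (q : SmashCoproduct k Γ H →ₗ[k] L) = functional z G := LinearMap.ext hν
  rw [← functional_convolution, ← h1, ← h2, TensorProduct.map_comp]
  simp only [LinearMap.comp_apply]
  congr 2
  exact (CoalgHomClass.map_comp_comul_apply q a).symm

lemma Factors.one : Factors q (1 : H) (1 : Γ → k) := by
  refine ⟨Coalgebra.counit, fun a => ?_⟩
  have h : (Coalgebra.counit : SmashCoproduct k Γ H →ₗ[k] k) = functional 1 1 :=
    linearMap_ext fun r f => by simp [counit_eq, counitLin_elt, functional_elt]
  rw [← h]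
  exact CoalgHomClass.counit_comp_apply q a

lemma Factors.add {y : H} {F G : Γ → k} (hF : Factors q y F) (hG : Factors q y G) :
    Factors q y (F + G) := by
  obtain ⟨μ, hμ⟩ := hF
  obtain ⟨ν, hν⟩ := hG
  have h : functional y (F + G) = functional (k := k) y F + functional y G :=
    linearMap_ext fun r f => by simp [functional_elt, add_mul]
  exact ⟨μ + ν, fun a => by simp [h, hμ, hν]⟩

lemma Factors.smul {y : H} {F : Γ → k} (c : k) (hF : Factors q y F) :
    Factors q y (c • F) := by
  obtain ⟨μ, hμ⟩ := hF
  have h : functional y (c • F) = c • functional (k := k) y F :=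
    linearMap_ext fun r f => by simp [functional_elt, mul_assoc]
  exact ⟨c • μ, fun a => by simp [h, hμ]⟩

variable (q) in
/-- The functions `F` on `Γ` for which `r # f ↦ F r * f 1` factors through `q`, as a subalgebra. -/
def factorsSubalgebra : Subalgebra k (Γ → k) where
  carrier := {F | Factors q 1 F}
  mul_mem' {F G} hF hG := by
    have h := Factors.mul hF hG
    simp only [mul_one, inv_one, one_smul] at h
    exact h
  add_mem' := Factors.add
  algebraMap_mem' c := by
    rw [Algebra.algebraMap_eq_smul_one]
    exact Factors.one.smul c

lemma Factors.mul_subalgebra {y : H} {F G : Γ → k} (hF : F ∈ factorsSubalgebra q)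
    (hG : Factors q y G) : Factors q y (F * G) := by
  have h := Factors.mul (q := q) hF hG
  simp only [one_mul, inv_one, one_smul] at h
  exact h

/-- Interpolation: multiply, over the points `s ≠ r` of `t`, functions of `B` that separate `s` from
`r`, each shifted by a constant to vanish at `s`. -/
lemma exists_separating {ι : Type*} (B : Subalgebra k (ι → k))
    (hB : ∀ r s, r ≠ s → ∃ F ∈ B, F r ≠ F s) (t : Finset ι) (r : ι) :
    ∃ F ∈ B, F r ≠ 0 ∧ ∀ s ∈ t, s ≠ r → F s = 0 := by
  classical
  choose! F hF hne using fun s (hs : r ≠ s) => hB r s hs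
  refine ⟨∏ s ∈ t.filter (· ≠ r), (F s - algebraMap k _ (F s s)), ?_, ?_, ?_⟩
  · refine B.prod_mem fun s hs => B.sub_mem (hF s ?_) (B.algebraMap_mem _)
    exact (Finset.mem_filter.1 hs).2.symm
  · rw [Finset.prod_apply, Finset.prod_ne_zero_iff]
    intro s hs
    exact sub_ne_zero.2 (hne s (Finset.mem_filter.1 hs).2.symm)
  · intro s hs hsr
    rw [Finset.prod_apply]
    exact Finset.prod_eq_zero (Finset.mem_filter.2 ⟨hs, hsr⟩) (sub_self _)

/-- A Hopf algebra map `q` on the smash coproduct is injective if the functions factoring through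
it separate the points of `Γ` at `1 : H`, and have no common zero at any `y : H`. -/
theorem injective_of_factors (h1 : ∀ r s : Γ, r ≠ s → ∃ F, Factors q 1 F ∧ F r ≠ F s)
    (h2 : ∀ (y : H) (r : Γ), ∃ F, Factors q y F ∧ F r ≠ 0) : Function.Injective q := by
  rw [injective_iff_map_eq_zero]
  intro a ha
  obtain ⟨f, rfl⟩ := exists_eq_sum_elt a
  suffices h : ∀ r ∈ f.support, ∀ y, f r y = 0 by
    refine Finset.sum_eq_zero fun r hr => ?_
    rw [show f r = 0 from funext (h r hr), elt_zero]
  intro r hr y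
  -- `F` isolates `r` within the support and `G` moves the functional to `y`, so the functional of
  -- `F * G` reads off a nonzero multiple of `f r y`.
  obtain ⟨G, hG, hGr⟩ := h2 y r
  obtain ⟨F, hF, hFr, hF0⟩ := exists_separating (factorsSubalgebra q) h1 f.support r
  obtain ⟨μ, hμ⟩ := Factors.mul_subalgebra hF hG
  have h := hμ (∑ r ∈ f.support, elt r (f r))
  rw [ha, map_zero, map_sum, Finset.sum_eq_single r] at h
  · rw [functional_elt] at h
    simpa [hFr, hGr] using h.symm
  · intro s hs hsr
    simp [functional_elt, hF0 s hs hsr]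
  · exact fun h => (h hr).elim

end SmashCoproduct

end HopfQuotient

/-! ### The structure of `Γ_{M,N}` -/

namespace Gamma

variable {M N : ℕ}

/-- The generators have finite order, so they generate the group as a monoid and inverses need no
separate case. -/
lemma induction_mul_g [NeZero N] {P : Gamma M N → Prop} (one : P 1)
    (mul_g : ∀ r i, P r → P (r * g i)) (r : Gamma M N) : P r := by
  have hfin : ∀ x ∈ Set.range (g : ZMod M → Gamma M N), IsOfFinOrder x := by
    rintro _ ⟨i, rfl⟩
    exact isOfFinOrder_iff_pow_eq_one.2 ⟨N, NeZero.pos N, g_pow i⟩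
  have hr : r ∈ Submonoid.closure (Set.range (g : ZMod M → Gamma M N)) := by
    rw [← Subgroup.closure_toSubmonoid_of_isOfFinOrder hfin]
    change r ∈ Subgroup.closure (Set.range PresentedGroup.of)
    rw [PresentedGroup.closure_range_of]
    trivial
  induction hr using Submonoid.closure_induction_right with
  | one => exact one
  | mul_right x _ y hy ih =>
    obtain ⟨i, rfl⟩ := hy
    exact mul_g x i ih

/-- The degree `Γ_{M,N} → ℤ/N`, with `g_i ↦ 1`. -/
def deg : Gamma M N →* Multiplicative (ZMod N) :=
  lift (fun _ => Multiplicative.ofAdd 1) (fun _ => by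
    rw [← ofAdd_nsmul, nsmul_one, ZMod.natCast_self, ofAdd_zero]) (fun _ _ => Commute.all _ _)

@[simp] lemma deg_g (i : ZMod M) : deg (g i : Gamma M N) = Multiplicative.ofAdd 1 := lift_g ..

lemma deg_smul [NeZero N] (a : Multiplicative (ZMod M)) (r : Gamma M N) :
    deg (a • r) = deg r := by
  induction r using induction_mul_g with
  | one => rw [smul_one]
  | mul_g r i ih => rw [smul_mul', map_mul, map_mul, ih, smul_g, deg_g, deg_g]

/-- A subgroup containing the elements `g_0^d g_i g_0^{-(d+1)}` contains the kernel of the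
degree. -/
lemma ker_deg_le [NeZero N] {K : Subgroup (Gamma M N)}
    (hK : ∀ (i : ZMod M) (d : ℕ), g 0 ^ d * g i * (g 0 ^ (d + 1))⁻¹ ∈ K) :
    (deg : Gamma M N →* _).ker ≤ K := by
  -- Here `j` is the length of a positive word for `r`. In degree zero `N` divides it, so the factor
  -- `g_0^j` disappears.
  have h : ∀ r : Gamma M N, ∃ j : ℕ, r * (g 0 ^ j)⁻¹ ∈ K ∧
      deg r = Multiplicative.ofAdd (j : ZMod N) := by
    intro r
    induction r using induction_mul_g with
    | one => exact ⟨0, by simp, by simp⟩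
    | mul_g r i ih =>
      obtain ⟨j, hj, hd⟩ := ih
      refine ⟨j + 1, ?_, ?_⟩
      · convert K.mul_mem hj (hK i j) using 1
        group
      · rw [map_mul, hd, deg_g, ← ofAdd_add]
        push_cast
        rfl
  intro r hr
  obtain ⟨j, hj, hd⟩ := h r
  rw [MonoidHom.mem_ker.1 hr, eq_comm, ofAdd_eq_one, ZMod.natCast_eq_zero_iff] at hd
  obtain ⟨m, rfl⟩ := hd
  rwa [pow_mul, g_pow, one_pow, inv_one, mul_one] at hj

lemma commute_list (l l' : List (ZMod M)) (hl : l.length = N) (hl' : l'.length = N) :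
    Commute (l.map (g : ZMod M → Gamma M N)).prod (l'.map g).prod := by
  have key : ∀ l : List (ZMod M), l.length = N → ∃ i : Fin N → ZMod M, List.ofFn i = l := by
    rintro l rfl
    exact ⟨l.get, List.ofFn_get l⟩
  obtain ⟨i, rfl⟩ := key l hl
  obtain ⟨j, rfl⟩ := key l' hl'
  simpa [List.map_ofFn, Function.comp_def] using g_commute i j

/-- Because `g_0^N = 1`, the negative power of `g_0` can be replaced by a positive one. This
exhibits the element as a word of length exactly `N`, to which the commutator relations apply. -/
lemma exists_list_eq [NeZero N] (i : ZMod M) (d : ℕ) : ∃ l : List (ZMod M), l.length = N ∧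
    (l.map g).prod = (g 0 ^ d * g i * (g 0 ^ (d + 1))⁻¹ : Gamma M N) := by
  have hd : d % N < N := Nat.mod_lt _ (NeZero.pos N)
  refine ⟨List.replicate (d % N) 0 ++ i :: List.replicate (N - 1 - d % N) 0, ?_, ?_⟩
  · simp only [List.length_append, List.length_cons, List.length_replicate]
    omega
  · have e1 : (g 0 ^ d : Gamma M N) = g 0 ^ (d % N) := by
      conv_lhs => rw [← Nat.mod_add_div d N, pow_add, pow_mul, g_pow, one_pow, mul_one]
    have e2 : (g 0 ^ (N - 1 - d % N) : Gamma M N) = (g 0 ^ (d + 1))⁻¹ := by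
      rw [eq_inv_iff_mul_eq_one, pow_succ, e1, ← pow_succ, ← pow_add,
        show N - 1 - d % N + (d % N + 1) = N by omega, g_pow]
    rw [← e2, e1]
    simp [mul_assoc]

lemma commute_of_deg_eq_one [NeZero N] {s t : Gamma M N} (hs : deg s = 1) (ht : deg t = 1) :
    s * t = t * s := by
  let V : Set (Gamma M N) :=
    Set.range fun x : ZMod M × ℕ => g 0 ^ x.2 * g x.1 * (g 0 ^ (x.2 + 1))⁻¹
  have hV : ∀ x ∈ V, ∀ y ∈ V, x * y = y * x := by
    rintro _ ⟨⟨i, d⟩, rfl⟩ _ ⟨⟨j, e⟩, rfl⟩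
    obtain ⟨l, hl, h⟩ := exists_list_eq (N := N) i d
    obtain ⟨l', hl', h'⟩ := exists_list_eq (N := N) j e
    simp only [← h, ← h']
    exact commute_list l l' hl hl'
  have hle : (deg : Gamma M N →* _).ker ≤ Subgroup.closure V :=
    ker_deg_le fun i d => Subgroup.subset_closure ⟨(i, d), rfl⟩
  have := Subgroup.isMulCommutative_closure hV
  exact congrArg Subtype.val
    (mul_comm' (⟨s, hle hs⟩ : Subgroup.closure V) ⟨t, hle ht⟩)

instance [NeZero N] : CommGroup (deg : Gamma M N →* _).ker where
  mul_comm s t := Subtype.ext (commute_of_deg_eq_one s.2 t.2)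

end Gamma

/-! ### Weights of the representations `ρ_Q` -/

section Weight

open Gamma

variable {k : Type*} [Field k] {M N : ℕ} (Q : ZMod M → ZMod N → kˣ)

/-- The coefficient in row `d` of the monomial matrix through which `r` acts. -/
def weight (r : Gamma M N) (d : ZMod N) : k := rhoGamma Q r 1 d

lemma rhoGamma_g (i : ZMod M) (v : ZMod N → k) (d : ZMod N) :
    rhoGamma Q (g i) v d = theta Q i (d + 1) * v (d + 1) := by
  rw [rhoGamma, lift_g]; rfl

lemma weight_g (i : ZMod M) (d : ZMod N) : weight Q (g i) d = theta Q i (d + 1) := by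
  rw [weight, rhoGamma_g, Pi.one_apply, mul_one]

/-- The quotient telescopes, since `i ↦ i - 1` permutes `ℤ/M`. -/
lemma prod_theta_col [NeZero M] (c : ZMod N) : ∏ i, theta Q i c = 1 := by
  have e : ∀ f : ZMod M → kˣ, ∏ i, f (i - 1) = ∏ i, f i :=
    fun f => Equiv.prod_comp (Equiv.subRight 1) f
  simp only [theta, Finset.prod_div_distrib, Finset.prod_mul_distrib]
  rw [e fun i => Q i c, e fun i => Q i (c - 1), div_self']

variable [NeZero N]

lemma prod_theta_row (i : ZMod M) : ∏ c, theta Q i c = 1 := by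
  have e : ∀ f : ZMod N → kˣ, ∏ i, f (i - 1) = ∏ i, f i :=
    fun f => Equiv.prod_comp (Equiv.subRight 1) f
  simp only [theta, Finset.prod_div_distrib, Finset.prod_mul_distrib]
  rw [e (Q i), e (Q (i - 1)), mul_comm, div_self']

/-- Every group element acts by a monomial matrix: a diagonal matrix times the shift by its degree.
Evaluating at the constant vector `1` identifies the diagonal entries with `weight`. -/
lemma rhoGamma_apply (r : Gamma M N) (v : ZMod N → k) (d : ZMod N) :
    rhoGamma Q r v d = weight Q r d * v (d + (deg r).toAdd) := by
  suffices h : ∃ w : ZMod N → k, ∀ v d, rhoGamma Q r v d = w d * v (d + (deg r).toAdd) by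
    obtain ⟨w, hw⟩ := h
    rw [weight, hw, hw, Pi.one_apply, mul_one]
  induction r using induction_mul_g with
  | one => exact ⟨1, fun v d => by simp⟩
  | mul_g r i ih =>
    obtain ⟨w, hw⟩ := ih
    refine ⟨fun d => w d * theta Q i (d + (deg r).toAdd + 1), fun v d => ?_⟩
    rw [map_mul, LinearEquiv.mul_apply, hw, rhoGamma_g, map_mul, deg_g, toAdd_mul, toAdd_ofAdd,
      mul_assoc, add_assoc]

lemma weight_mul (r s : Gamma M N) (d : ZMod N) :
    weight Q (r * s) d = weight Q r d * weight Q s (d + (deg r).toAdd) := by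
  rw [weight, map_mul, LinearEquiv.mul_apply, rhoGamma_apply]
  rfl

omit [NeZero N] in
@[simp] lemma weight_one (d : ZMod N) : weight Q 1 d = 1 := by
  simp [weight]

lemma weight_ne_zero (r : Gamma M N) (d : ZMod N) : weight Q r d ≠ 0 := by
  have h := weight_mul Q r r⁻¹ d
  rw [mul_inv_cancel, weight_one] at h
  exact left_ne_zero_of_mul (h ▸ one_ne_zero)

/-- Each row of `θ` has product `1`. This is what later forces a scalar action to be by an `N`-th
root of unity. -/
lemma prod_weight (r : Gamma M N) : ∏ d, weight Q r d = 1 := by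
  induction r using induction_mul_g with
  | one => simp
  | mul_g r i ih =>
    simp only [weight_mul, weight_g, Finset.prod_mul_distrib, ih, one_mul, add_assoc]
    refine (Equiv.prod_comp (Equiv.addRight ((deg r).toAdd + 1)) fun c => (theta Q i c : k)).trans ?_
    rw [← Units.coe_prod, prod_theta_row, Units.val_one]

lemma rhoGamma_pow_apply {t : Gamma M N} (ht : deg t = 1) (n : ℕ) (v : ZMod N → k) (d : ZMod N) :
    (rhoGamma Q t ^ n) v d = weight Q t d ^ n * v d := by
  induction n with
  | zero => simp
  | succ n ih =>
    rw [pow_succ', LinearEquiv.mul_apply, rhoGamma_apply, ht, toAdd_one, add_zero, ih]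
    ring

lemma isOfFinOrder_rhoGamma_iff {t : Gamma M N} (ht : deg t = 1) :
    IsOfFinOrder (rhoGamma Q t) ↔ ∃ n, 0 < n ∧ ∀ d, weight Q t d ^ n = 1 := by
  rw [isOfFinOrder_iff_pow_eq_one]
  refine exists_congr fun n => and_congr_right fun _ => ⟨fun h d => ?_, fun h => ?_⟩
  · have h' := rhoGamma_pow_apply Q ht n 1 d
    rw [h] at h'
    simpa using h'.symm
  · refine LinearEquiv.ext fun v => funext fun d => ?_
    rw [rhoGamma_pow_apply Q ht, h, one_mul]
    rfl

omit [NeZero N] in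
lemma deg_g_mul_inv (i j : ZMod M) : deg (g i * (g j)⁻¹ : Gamma M N) = 1 := by simp

/-- If all `g_{i+1} g_i⁻¹` act with finite order, then the entries of `Q` are roots of unity. -/
lemma isOfFinOrder_of_rhoGamma [NeZero M] (hQ₀ : ∀ c, Q 0 c = 1) (hQ₁ : ∀ i, Q i 0 = 1)
    (h : ∀ i : ZMod M, IsOfFinOrder (rhoGamma Q (g (i + 1) * (g i)⁻¹))) (i : ZMod M)
    (c : ZMod N) : IsOfFinOrder (Q i c) := by
  have ind : ∀ {n : ℕ} [NeZero n] {P : ZMod n → Prop}, P 0 → (∀ a, P a → P (a + 1)) →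
      ∀ a, P a := by
    intro n _ P h0 h1 a
    rw [← ZMod.natCast_zmod_val a]
    induction a.val with
    | zero => simpa using h0
    | succ m ih => simpa using h1 _ ih
  have h1 : ∀ i c, theta Q (i + 1) c / theta Q i c ∈ CommGroup.torsion kˣ := by
    intro i c
    obtain ⟨n, hn, hw⟩ := (isOfFinOrder_rhoGamma_iff Q (deg_g_mul_inv _ _)).1 (h i)
    refine isOfFinOrder_iff_pow_eq_one.2 ⟨n, hn, ?_⟩
    have e := weight_mul Q (g (i + 1) * (g i)⁻¹) (g i) (c - 1)
    rw [inv_mul_cancel_right, deg_g_mul_inv, toAdd_one, add_zero, weight_g, weight_g,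
      sub_add_cancel] at e
    ext
    rw [Units.val_pow_eq_pow_val, Units.val_div_eq_div_val, e,
      mul_div_cancel_right₀ _ (Units.ne_zero _), hw, Units.val_one]
  have h2 : ∀ i c, theta Q i c / theta Q 0 c ∈ CommGroup.torsion kˣ := fun i c =>
    ind (P := fun i => theta Q i c / theta Q 0 c ∈ CommGroup.torsion kˣ)
      (by rw [div_self']; exact one_mem _)
      (fun a ha => by rw [← div_mul_div_cancel _ (theta Q a c)]; exact mul_mem (h1 a c) ha) i
  -- Column `c` of `θ` has product `1`, so the product over `i` of the ratios in `h2` is the inverse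
  -- of `θ_{0c}^M`.
  have h3 : ∀ c, theta Q 0 c ∈ CommGroup.torsion kˣ := by
    intro c
    have hp := prod_mem (S := CommGroup.torsion kˣ) (t := Finset.univ)
      (f := fun i => theta Q i c / theta Q 0 c) fun i _ => h2 i c
    rw [Finset.prod_div_distrib, prod_theta_col, Finset.prod_const, one_div,
      inv_mem_iff, Finset.card_univ, ZMod.card] at hp
    exact IsOfFinOrder.of_pow hp (NeZero.ne M)
  have h4 : ∀ i c, theta Q i c ∈ CommGroup.torsion kˣ := fun i c => by
    rw [← div_mul_cancel (theta Q i c) (theta Q 0 c)]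
    exact mul_mem (h2 i c) (h3 c)
  -- `θ` is a multiplicative second difference of `Q`. It is summed back along `c` starting from
  -- `Q_{i0} = 1`, then along `i` starting from `Q_{0c} = 1`.
  have h5 : ∀ i c, Q i c / Q (i + 1) c ∈ CommGroup.torsion kˣ := fun i c =>
    ind (P := fun c => Q i c / Q (i + 1) c ∈ CommGroup.torsion kˣ)
      (by rw [hQ₁, hQ₁, div_self']; exact one_mem _)
      (fun c hc => by
        have h := mul_mem (h4 (i + 1) (c + 1)) hc
        rwa [theta_eq, add_sub_cancel_right, add_sub_cancel_right, div_mul_cancel] at h) c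
  exact ind (P := fun i => Q i c ∈ CommGroup.torsion kˣ) (by rw [hQ₀]; exact one_mem _)
    (fun i hi => by
      have h := mul_mem (inv_mem (h5 i c)) hi
      rwa [inv_div, div_mul_cancel] at h) i

open SmashCoproduct

variable {Q}

/-- This is the matrix coefficient of `ρ_Q` in row `d` and column `d + j`. It vanishes off degree
`j` because the matrices are monomial. -/
lemma factors_weight [NeZero M] (G : HopfFactorization (rhoQ Q)) (j : Multiplicative (ZMod N))
    (d : ZMod N) :
    Factors G.q (Multiplicative.ofAdd (1 : ZMod M))
      (fun r => if deg r = j then weight Q r d else 0) := by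
  let μ : G.L →ₗ[k] k := LinearMap.proj d ∘ₗ
    LinearMap.applyₗ (Pi.single (d + j.toAdd) (1 : k)) ∘ₗ G.φ.toLinearMap
  have h : μ ∘ₗ (G.q : SmashCoproduct k (Gamma M N) (Multiplicative (ZMod M)) →ₗ[k] G.L) =
      functional (Multiplicative.ofAdd (1 : ZMod M))
        (fun r => if deg r = j then weight Q r d else 0) := by
    refine linearMap_ext fun r f => ?_
    rw [functional_elt]
    change (G.φ (G.q (elt r f))) (Pi.single (d + j.toAdd) (1 : k)) d = _
    rw [G.fac, rhoQ, algLift_elt]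
    change rhoGamma Q r (f (Multiplicative.ofAdd 1) • Pi.single (d + j.toAdd) (1 : k)) d = _
    rw [map_smul, Pi.smul_apply, rhoGamma_apply, smul_eq_mul, mul_comm]
    by_cases hj : deg r = j
    · simp [hj]
    · simp [hj]
  exact ⟨μ, fun a => LinearMap.congr_fun h a⟩

lemma factors_prod_weight [NeZero M] (G : HopfFactorization (rhoQ Q))
    (j : Multiplicative (ZMod N)) (c : ℕ → ZMod N) (n : ℕ) :
    Factors G.q (Multiplicative.ofAdd (1 : ZMod M) ^ n)
      (fun r => ∏ i ∈ Finset.range n, if deg r = j then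
        weight Q ((Multiplicative.ofAdd (1 : ZMod M) ^ i)⁻¹ • r) (c i) else 0) := by
  induction n with
  | zero =>
    simp only [pow_zero, Finset.range_zero, Finset.prod_empty]
    exact Factors.one
  | succ n ih =>
    have h := ih.mul (factors_weight G j (c n))
    simp only [deg_smul] at h
    simpa only [pow_succ, Finset.prod_range_succ] using h

lemma ofAdd_one_pow_val [NeZero M] (a : Multiplicative (ZMod M)) :
    Multiplicative.ofAdd (1 : ZMod M) ^ a.toAdd.val = a := by
  rw [← ofAdd_nsmul, nsmul_one, ZMod.natCast_zmod_val, ofAdd_toAdd]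

/-- `ρ_Q` is inner faithful provided no nontrivial element of degree `0` acts, together with its
translates under `ℤ/M`, with finite order. -/
theorem innerFaithful_rhoQ [NeZero M]
    (h : ∀ t : Gamma M N, deg t = 1 →
      (∀ a : Multiplicative (ZMod M), IsOfFinOrder (rhoGamma Q (a • t))) → t = 1) :
    InnerFaithful (rhoQ Q) := by
  refine InnerFaithful.of_injective fun G => injective_of_factors (fun r s hrs => ?_) ?_
  · have hM : Multiplicative.ofAdd (1 : ZMod M) ^ M = 1 := by
      rw [← ofAdd_nsmul, nsmul_one, ZMod.natCast_self, ofAdd_zero]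
    by_contra! H
    have hF : ∀ c : ℕ → ZMod N, _ := fun c => H _ (hM ▸ factors_prod_weight G (deg r) c M)
    by_cases hd : deg s = deg r
    · refine hrs (inv_mul_eq_one.1 (h _ (by rw [map_mul, map_inv, hd, inv_mul_cancel]) ?_))
      obtain ⟨t, rfl⟩ : ∃ t, s = r * t := ⟨r⁻¹ * s, by group⟩
      have ht : deg t = 1 := by simpa using hd
      rw [inv_mul_cancel_left]
      have hprod : ∀ c : ℕ → ZMod N, ∏ i ∈ Finset.range M,
          weight Q ((Multiplicative.ofAdd (1 : ZMod M) ^ i)⁻¹ • t) (c i) = 1 := by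
        intro c
        -- The offset compensates the shift by `deg r` in `weight_mul`, so that `t` is evaluated
        -- exactly at `c i`.
        have e := hF fun i => c i - (deg r).toAdd
        simp only [hd, if_true, smul_mul', weight_mul, deg_smul, sub_add_cancel,
          Finset.prod_mul_distrib] at e
        exact mul_left_cancel₀ (Finset.prod_ne_zero_iff.2 fun i _ => weight_ne_zero _ _ _)
          (e.symm.trans (mul_one _).symm)
      intro a
      have hda : deg (a • t) = 1 := by rw [deg_smul, ht]
      obtain ⟨i, hi, rfl⟩ : ∃ i < M, a = (Multiplicative.ofAdd (1 : ZMod M) ^ i)⁻¹ :=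
        ⟨(a⁻¹).toAdd.val, ZMod.val_lt _, by rw [ofAdd_one_pow_val, inv_inv]⟩
      refine (isOfFinOrder_rhoGamma_iff Q hda).2 ⟨N, NeZero.pos N, ?_⟩
      set w := weight Q ((Multiplicative.ofAdd (1 : ZMod M) ^ i)⁻¹ • t)
      -- Only the `i`-th coordinate of `c` is varied, the other factors being fixed at `0`: the
      -- translate acts by a scalar.
      have hconst : ∀ d, w d = w 0 := by
        have key : ∀ d, w d * ∏ l ∈ (Finset.range M).erase i,
            weight Q ((Multiplicative.ofAdd (1 : ZMod M) ^ l)⁻¹ • t) 0 = 1 := by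
          intro d
          rw [← hprod (Function.update 0 i d), ← Finset.mul_prod_erase _ _ (Finset.mem_range.2 hi),
            Function.update_self]
          congr 1
          refine Finset.prod_congr rfl fun l hl => ?_
          rw [Function.update_of_ne (Finset.ne_of_mem_erase hl), Pi.zero_apply]
        intro d
        exact mul_right_cancel₀ (right_ne_zero_of_mul_eq_one (key 0))
          ((key d).trans (key 0).symm)
      intro d
      have hw := prod_weight Q ((Multiplicative.ofAdd (1 : ZMod M) ^ i)⁻¹ • t)
      change ∏ d, w d = 1 at hw
      simp only [hconst, Finset.prod_const, Finset.card_univ, ZMod.card] at hw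
      rw [hconst, hw]
    -- In different degrees the indicator already separates: the product is nonzero at `r` and zero
    -- at `s`.
    · have e := hF 0
      simp only [hd, if_true, if_false, Finset.prod_const, Finset.card_range] at e
      rw [zero_pow (NeZero.ne M)] at e
      exact Finset.prod_ne_zero_iff.2 (fun i _ => weight_ne_zero _ _ _) e
  · intro y r
    refine ⟨_, ofAdd_one_pow_val y ▸ factors_prod_weight G (deg r) 0 y.toAdd.val, ?_⟩
    simp only [if_true]
    exact Finset.prod_ne_zero_iff.2 fun i _ => weight_ne_zero _ _ _

end Weight

/-! ### Cyclic modules over `ℤ[ζ_p]` -/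

section Cyclotomic

open Polynomial

/-- Over `ℤ`, the cyclotomic polynomial `Φ_n` divides `f` or is coprime to `f` up to a nonzero
constant. -/
lemma cyclotomic_dvd_or_exists_eq_C {n : ℕ} (hn : 0 < n) (f : ℤ[X]) :
    cyclotomic n ℤ ∣ f ∨ ∃ (a b : ℤ[X]) (m : ℤ), m ≠ 0 ∧ a * f + b * cyclotomic n ℤ = C m := by
  refine or_iff_not_imp_left.2 fun h => ?_
  have inj : Function.Injective (algebraMap ℤ ℚ) := (algebraMap ℤ ℚ).injective_int
  have hndvd : ¬ cyclotomic n ℚ ∣ f.map (algebraMap ℤ ℚ) := by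
    rwa [← map_cyclotomic n (algebraMap ℤ ℚ), map_dvd_map _ inj (cyclotomic.monic n ℤ)]
  obtain ⟨A, B, hAB⟩ := ((cyclotomic.irreducible_rat hn).coprime_iff_not_dvd.2 hndvd).symm
  -- Clearing denominators in the rational Bézout identity produces the constant `x * y`.
  obtain ⟨x, hx, hxA⟩ := IsLocalization.integerNormalization_spec (nonZeroDivisors ℤ) A
  obtain ⟨y, hy, hyB⟩ := IsLocalization.integerNormalization_spec (nonZeroDivisors ℤ) B
  refine ⟨C y * IsLocalization.integerNormalization (nonZeroDivisors ℤ) A,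
    C x * IsLocalization.integerNormalization (nonZeroDivisors ℤ) B, x * y,
    mul_ne_zero (nonZeroDivisors.ne_zero hx) (nonZeroDivisors.ne_zero hy), ?_⟩
  apply map_injective _ inj
  simp only [Polynomial.map_add, Polynomial.map_mul, hxA, hyB, map_C, map_cyclotomic, map_mul]
  rw [← algebraMap_smul ℚ x, ← algebraMap_smul ℚ y, smul_eq_C_mul, smul_eq_C_mul]
  linear_combination C (algebraMap ℤ ℚ x) * C (algebraMap ℤ ℚ y) * hAB

lemma aeval_apply_mem {V : Type*} [AddCommGroup V] {τ : Module.End ℤ V} {S : AddSubgroup V}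
    (hS : ∀ v ∈ S, τ v ∈ S) (f : ℤ[X]) {v : V} (hv : v ∈ S) : aeval τ f v ∈ S := by
  induction f using Polynomial.induction_on' with
  | add f g hf hg =>
    rw [map_add, LinearMap.add_apply]
    exact S.add_mem hf hg
  | monomial n a =>
    rw [aeval_monomial, Module.End.mul_apply, Module.algebraMap_end_apply]
    refine S.zsmul_mem ?_ a
    induction n with
    | zero => simpa using hv
    | succ n ih =>
      rw [pow_succ', Module.End.mul_apply]
      exact hS _ ih

/-- In a module generated by `u` over `ℤ[ζ_p]`, a submodule which contains no nonzero multiple of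
`u` is zero. -/
lemma aeval_apply_eq_zero {V : Type*} [AddCommGroup V] {τ : Module.End ℤ V} {u : V} {p : ℕ}
    (hp : p.Prime) (hu : ∑ i ∈ Finset.range p, (τ ^ i) u = 0) {S : AddSubgroup V}
    (hS : ∀ v ∈ S, τ v ∈ S) (huS : ∀ m : ℤ, m ≠ 0 → m • u ∉ S) {f : ℤ[X]}
    (hf : aeval τ f u ∈ S) : aeval τ f u = 0 := by
  have hΦ : aeval τ (cyclotomic p ℤ) u = 0 := by
    have := Fact.mk hp
    rw [cyclotomic_prime, map_sum, LinearMap.sum_apply]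
    simpa using hu
  obtain ⟨b, rfl⟩ | ⟨a, b, m, hm, h⟩ := cyclotomic_dvd_or_exists_eq_C hp.pos f
  · rw [mul_comm, map_mul, Module.End.mul_apply, hΦ, map_zero]
  · refine absurd ?_ (huS m hm)
    have e : aeval τ (a * f + b * cyclotomic p ℤ) u = m • u := by
      rw [h, aeval_C, Module.algebraMap_end_apply]
    rw [← e, map_add, map_mul, map_mul, LinearMap.add_apply, Module.End.mul_apply,
      Module.End.mul_apply, hΦ, map_zero, add_zero]
    exact aeval_apply_mem hS a hf

end Cyclotomic

/-! ### The degree zero part of `Γ_{M,N}` as a cyclic module -/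

namespace Gamma

open Polynomial

variable {M N : ℕ} [NeZero N]

/-- The element `g_1 g_0⁻¹` of the kernel of the degree. -/
def kerGen (M N : ℕ) : (deg : Gamma M N →* _).ker :=
  ⟨g 1 * (g 0)⁻¹, MonoidHom.mem_ker.2 (by simp)⟩

/-- Conjugation by `g_0` on the kernel of the degree. -/
def conjEnd (M N : ℕ) [NeZero N] : Module.End ℤ (Additive (deg : Gamma M N →* _).ker) :=
  (MonoidHom.toAdditive (MulAut.conjNormal (g 0) : MulAut (deg : Gamma M N →* _).ker)
    |>.toIntLinearMap)

lemma conjEnd_val (v : Additive (deg : Gamma M N →* _).ker) :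
    ((conjEnd M N v).toMul : Gamma M N) = g 0 * (v.toMul : Gamma M N) * (g 0)⁻¹ :=
  MulAut.conjNormal_apply _ _

/-- The action of the generator of `ℤ/M` on the kernel of the degree. -/
def shiftEnd (M N : ℕ) [NeZero N] : Module.End ℤ (Additive (deg : Gamma M N →* _).ker) :=
  (MonoidHom.toAdditive
    (((MulDistribMulAction.toMonoidHom (Gamma M N)
      (Multiplicative.ofAdd (1 : ZMod M))).comp (Subgroup.subtype _)).codRestrict
        (deg : Gamma M N →* _).ker fun t => MonoidHom.mem_ker.2 (by
          change deg (Multiplicative.ofAdd (1 : ZMod M) • (t : Gamma M N)) = 1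
          rw [deg_smul]
          exact t.2))).toIntLinearMap

lemma shiftEnd_val (v : Additive (deg : Gamma M N →* _).ker) :
    ((shiftEnd M N v).toMul : Gamma M N) =
      Multiplicative.ofAdd (1 : ZMod M) • (v.toMul : Gamma M N) := rfl

lemma conjEnd_pow_kerGen (n : ℕ) :
    (((conjEnd M N ^ n) (Additive.ofMul (kerGen M N))).toMul : Gamma M N) =
      g 0 ^ n * g 1 * (g 0 ^ (n + 1))⁻¹ := by
  induction n with
  | zero => simp [kerGen]
  | succ n ih =>
    rw [pow_succ', Module.End.mul_apply, conjEnd_val, ih]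
    group

/-- The product telescopes. At `n = N` both powers are trivial, which gives the relation `Φ_N(τ) u =
0` when `N` is prime. -/
lemma sum_conjEnd_pow_kerGen (n : ℕ) :
    ((∑ i ∈ Finset.range n, (conjEnd M N ^ i) (Additive.ofMul (kerGen M N))).toMul : Gamma M N) =
      g 1 ^ n * (g 0 ^ n)⁻¹ := by
  induction n with
  | zero => simp
  | succ n ih =>
    rw [Finset.sum_range_succ, toMul_add, Subgroup.coe_mul, ih, conjEnd_pow_kerGen]
    group

lemma shiftEnd_pow_kerGen (n : ℕ) :
    (((shiftEnd M N ^ n) (Additive.ofMul (kerGen M N))).toMul : Gamma M N) =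
      g (n + 1 : ℕ) * (g (n : ℕ))⁻¹ := by
  induction n with
  | zero => simp [kerGen]
  | succ n ih =>
    rw [pow_succ', Module.End.mul_apply, shiftEnd_val, ih, smul_mul', smul_inv', smul_g, smul_g, toAdd_ofAdd]
    push_cast
    rfl

/-- For `n = M` the index wraps around to `0`, which gives `Φ_M(τ) u = 0` when `M` is prime. Smaller
`n` yield all the `g_i g_0⁻¹`. -/
lemma sum_shiftEnd_pow_kerGen (n : ℕ) :
    ((∑ i ∈ Finset.range n, (shiftEnd M N ^ i) (Additive.ofMul (kerGen M N))).toMul :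
      Gamma M N) = g (n : ℕ) * (g 0)⁻¹ := by
  induction n with
  | zero => simp
  | succ n ih =>
    rw [Finset.sum_range_succ_comm, toMul_add, Subgroup.coe_mul, ih, shiftEnd_pow_kerGen]
    group

/-- The elements `f(τ) u` with `f ∈ ℤ[X]` and `u = g_1 g_0⁻¹`, as a subgroup of `Γ_{M,N}`. -/
def cyclicSubgroup (τ : Module.End ℤ (Additive (deg : Gamma M N →* _).ker)) :
    Subgroup (Gamma M N) where
  carrier := {t | ∃ f : ℤ[X], ((aeval τ f (Additive.ofMul (kerGen M N))).toMul : Gamma M N) = t}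
  one_mem' := ⟨0, by simp⟩
  mul_mem' := by
    rintro _ _ ⟨f, rfl⟩ ⟨f', rfl⟩
    exact ⟨f + f', by simp⟩
  inv_mem' := by
    rintro _ ⟨f, rfl⟩
    exact ⟨-f, by simp⟩

lemma sum_pow_mem_cyclicSubgroup (τ : Module.End ℤ (Additive (deg : Gamma M N →* _).ker))
    (s : Finset ℕ) :
    ((∑ i ∈ s, (τ ^ i) (Additive.ofMul (kerGen M N))).toMul : Gamma M N) ∈ cyclicSubgroup τ :=
  ⟨∑ i ∈ s, X ^ i, by simp [LinearMap.sum_apply]⟩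

lemma ker_deg_le_cyclicSubgroup_conjEnd :
    (deg : Gamma 2 N →* _).ker ≤ cyclicSubgroup (conjEnd 2 N) := by
  refine ker_deg_le fun i d => ?_
  obtain rfl | rfl : i = 0 ∨ i = 1 := by revert i; decide
  · rw [← pow_succ, mul_inv_cancel]
    exact one_mem _
  · rw [← conjEnd_pow_kerGen]
    simpa using sum_pow_mem_cyclicSubgroup (conjEnd 2 N) {d}

/-- The `g_i` are involutions, so only the parity of `d` matters: even `d` gives `g_i g_0⁻¹`, a
partial sum of the `τ^j u`, and odd `d` gives `g_0 g_i`, its inverse. -/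
lemma ker_deg_le_cyclicSubgroup_shiftEnd [NeZero M] :
    (deg : Gamma M 2 →* _).ker ≤ cyclicSubgroup (shiftEnd M 2) := by
  refine ker_deg_le fun i d => ?_
  have h : g i * (g 0)⁻¹ ∈ cyclicSubgroup (shiftEnd M 2) := by
    have h := sum_pow_mem_cyclicSubgroup (shiftEnd M 2) (Finset.range i.val)
    rwa [sum_shiftEnd_pow_kerGen, ZMod.natCast_zmod_val] at h
  have inv_g : ∀ j : ZMod M, (g j : Gamma M 2)⁻¹ = g j := fun j =>
    inv_eq_of_mul_eq_one_left (by rw [← pow_two, g_pow])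
  have pow_g : ∀ m, (g 0 : Gamma M 2) ^ (2 * m) = 1 := fun m => by rw [pow_mul, g_pow, one_pow]
  obtain ⟨m, rfl | rfl⟩ := Nat.even_or_odd' d
  · simpa only [pow_succ, pow_g, one_mul] using h
  · have h' := inv_mem h
    rw [mul_inv_rev, inv_inv, inv_g] at h'
    rw [pow_succ _ (2 * m), pow_g, one_mul, show 2 * m + 1 + 1 = 2 * (m + 1) by ring, pow_g,
      inv_one, mul_one]
    exact h'

end Gamma

/-! ### Elements acting with finite order, and the conclusion -/

section Main

open Gamma

variable {k : Type*} [Field k] {M N : ℕ} [NeZero N] (Q : ZMod M → ZMod N → kˣ)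

/-- The elements of degree `0` which act, together with their translates under `ℤ/M`, with finite
order. -/
def torsionSubgroup : Subgroup (deg : Gamma M N →* _).ker where
  carrier := {t | ∀ a : Multiplicative (ZMod M), IsOfFinOrder (rhoGamma Q (a • (t : Gamma M N)))}
  one_mem' a := by simp
  mul_mem' {s t} hs ht a := by
    rw [Subgroup.coe_mul, smul_mul', map_mul]
    -- Closure under products rests on the degree-zero part being abelian and stable under `ℤ/M`.
    refine Commute.isOfFinOrder_mul (Commute.map ?_ (rhoGamma Q)) (hs a) (ht a)
    exact commute_of_deg_eq_one (by rw [deg_smul]; exact s.2) (by rw [deg_smul]; exact t.2)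
  inv_mem' {t} ht a := by
    rw [Subgroup.coe_inv, smul_inv', map_inv]
    exact (ht a).inv

variable {Q}

/-- The translate by `a` of a conjugate by `g_0` is a conjugate by `a • g_0`, and conjugation
preserves finite order. -/
lemma conjEnd_mem_torsionSubgroup (v : Additive (deg : Gamma M N →* _).ker)
    (hv : v ∈ (torsionSubgroup Q).toAddSubgroup) :
    conjEnd M N v ∈ (torsionSubgroup Q).toAddSubgroup := by
  intro a
  change IsOfFinOrder (rhoGamma Q (a • ((conjEnd M N v).toMul : Gamma M N)))
  rw [conjEnd_val, smul_mul', smul_mul', smul_inv', map_mul, map_mul, map_inv]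
  exact (MulAut.conj (rhoGamma Q (a • g 0))).toMonoidHom.isOfFinOrder (hv a)

lemma shiftEnd_mem_torsionSubgroup (v : Additive (deg : Gamma M N →* _).ker)
    (hv : v ∈ (torsionSubgroup Q).toAddSubgroup) :
    shiftEnd M N v ∈ (torsionSubgroup Q).toAddSubgroup := by
  intro a
  change IsOfFinOrder (rhoGamma Q (a • ((shiftEnd M N v).toMul : Gamma M N)))
  rw [shiftEnd_val, smul_smul]
  exact hv _

/-- The translates of `u` are the elements `g_{i+1} g_i⁻¹`. If their `m`-th powers act with finite
order, so do they, and all entries of `Q` are roots of unity. -/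
lemma zsmul_kerGen_notMem_torsionSubgroup [NeZero M] (hQ₀ : ∀ c, Q 0 c = 1)
    (hQ₁ : ∀ i, Q i 0 = 1) (hQ : ∃ i c, ¬ IsOfFinOrder (Q i c)) (m : ℤ) (hm : m ≠ 0) :
    m • Additive.ofMul (kerGen M N) ∉ (torsionSubgroup Q).toAddSubgroup := by
  intro h
  obtain ⟨i, c, hic⟩ := hQ
  refine hic (isOfFinOrder_of_rhoGamma Q hQ₀ hQ₁ (fun i => ?_) i c)
  have h' : IsOfFinOrder (rhoGamma Q (Multiplicative.ofAdd i • ((kerGen M N : Gamma M N) ^ m))) :=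
    h (Multiplicative.ofAdd i)
  rw [smul_zpow', map_zpow, kerGen, smul_mul', smul_inv', smul_g, smul_g, toAdd_ofAdd, zero_add,
    add_comm] at h'
  obtain ⟨n, rfl | rfl⟩ := m.eq_nat_or_neg
  · rw [zpow_natCast] at h'
    exact h'.of_pow (by simpa using hm)
  · rw [zpow_neg, zpow_natCast, isOfFinOrder_inv_iff] at h'
    exact h'.of_pow (by simpa using hm)

lemma eq_one_of_forall_isOfFinOrder [NeZero M] {p : ℕ} (hp : p.Prime) (hQ₀ : ∀ c, Q 0 c = 1)
    (hQ₁ : ∀ i, Q i 0 = 1) (hQ : ∃ i c, ¬ IsOfFinOrder (Q i c))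
    (τ : Module.End ℤ (Additive (deg : Gamma M N →* _).ker))
    (hτ : (deg : Gamma M N →* _).ker ≤ cyclicSubgroup τ)
    (hτp : ∑ i ∈ Finset.range p, (τ ^ i) (Additive.ofMul (kerGen M N)) = 0)
    (hτS : ∀ v ∈ (torsionSubgroup Q).toAddSubgroup, τ v ∈ (torsionSubgroup Q).toAddSubgroup)
    (t : Gamma M N) (ht : deg t = 1)
    (h : ∀ a : Multiplicative (ZMod M), IsOfFinOrder (rhoGamma Q (a • t))) : t = 1 := by
  obtain ⟨f, rfl⟩ := hτ (MonoidHom.mem_ker.2 ht)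
  rw [aeval_apply_eq_zero hp hτp hτS (zsmul_kerGen_notMem_torsionSubgroup hQ₀ hQ₁ hQ) h]
  rfl

end Main

end

theorem theorem5p1 {k : Type*} [Field k] [CharZero k] (M N : ℕ) [NeZero M] [NeZero N]
    (hMN : (M = 2 ∧ N.Prime) ∨ (M.Prime ∧ N = 2))
    (Q : ZMod M → ZMod N → kˣ) (hQ₀ : ∀ c, Q 0 c = 1) (hQ₁ : ∀ i, Q i 0 = 1)
    (hQ : ∃ i c, ¬ ∃ n : ℕ, 0 < n ∧ Q i c ^ n = 1) :
    InnerFaithful (rhoQ Q) := by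
  have hQ' : ∃ i c, ¬ IsOfFinOrder (Q i c) := by simpa only [isOfFinOrder_iff_pow_eq_one] using hQ
  refine innerFaithful_rhoQ ?_
  obtain ⟨rfl, hN⟩ | ⟨hM, rfl⟩ := hMN
  · refine eq_one_of_forall_isOfFinOrder hN hQ₀ hQ₁ hQ' (Gamma.conjEnd 2 N)
      Gamma.ker_deg_le_cyclicSubgroup_conjEnd (Subtype.ext ?_) conjEnd_mem_torsionSubgroup
    refine (Gamma.sum_conjEnd_pow_kerGen N).trans ?_
    rw [Gamma.g_pow, Gamma.g_pow, inv_one, mul_one]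
    rfl
  · refine eq_one_of_forall_isOfFinOrder hM hQ₀ hQ₁ hQ' (Gamma.shiftEnd M 2)
      Gamma.ker_deg_le_cyclicSubgroup_shiftEnd (Subtype.ext ?_) shiftEnd_mem_torsionSubgroup
    refine (Gamma.sum_shiftEnd_pow_kerGen M).trans ?_
    rw [ZMod.natCast_self, mul_inv_cancel]
    rfl
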